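/- Let $X\subseteq\mathbb R^n$ and $Z\subseteq\mathbb R^k$ be open with $0\in X$, and consider the control-affine system $$\dot\eta=\bar f(\eta)+\bar g(\eta)\mu,\qquad \dot z=p(\eta,z),\qquad (\eta,z)\in X\times Z,$$ with $\bar f,\bar g,p$ locally Lipschitz, in closed loop with a locally Lipschitz state feedback $\mu=\mu(\eta,z)\in\mathbb R^m$. Let $\mathscr O_Z\subset Z$ be an exponentially stable periodic orbit of the zero dynamics $\dot z=p(0,z)$, let $\iota_0(z)=(0,z)$ and $\mathscr O=\iota_0(\mathscr O_Z)$. (A periodic orbit is the image of a nonconstant periodic solution; it is exponentially stable if there are $\rho,N,\gamma>0$ such that from every initial state $x_0$ with $\operatorname{dist}(x_0,\mathscr O)<\rho$ a solution exists for all $t\ge 0$, and $\operatorname{dist}(x(t),\mathscr O)\le Ne^{-\gamma t}\operatorname{dist}(x_0,\mathscr O)$ along it.) Let $\epsilon,c_1,c_2,c_3>0$ and let $V_\epsilon:X\to\mathbb R$ be differentiable with $c_1\|\eta\|^2\le V_\epsilon(\eta)\le\frac{c_2}{\epsilon^2}\|\eta\|^2$ for all $\eta\in X$. Suppose that, for some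 $r>0$, along every closed-loop trajectory with $\eta(0)\ne 0$ that starts at distance less than $r$ from $\mathscr O$, for as long as it exists, the relaxed CLF inequality $$\dot V_\epsilon(\eta,\mu)+\frac{c_3}{\epsilon}V_\epsilon(\eta)\le d_\epsilon(t)$$ holds, where $\dot V_\epsilon(\eta,\mu)=L_{\bar f}V_\epsilon(\eta)+L_{\bar g}V_\epsilon(\eta)\mu$ and $d_\epsilon\ge0$ is a measurable function of time, which may depend on the trajectory. Put $w_\epsilon(t)=\int_0^t\frac{d_\epsilon(\tau)}{V_\epsilon(\eta(\tau))}\,d\tau$ and let $\bar w_\epsilon$ be the supremum of $w_\epsilon(t)$ over all $t\ge0$ and all these trajectories. If $\bar w_\epsilon$ is finite, then 1. along every closed-loop trajectory that starts at distance less than $r$ from $\mathscr O$, for as long as it exists, $$\|\eta(t)\|\le\sqrt{\frac{c_2}{c_1}}\,\frac1\epsilon\,e^{\bar w_\epsilon/2}\,e^{-\frac{c_3}{2\epsilon}t}\,\|\eta(0)\|;$$ 2. $\mathscr O=\iota_0(\mathscr O_Z)$ is an exponentially stable periodic orbit of the closed-loop system. -/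

import Mathlib

open Set Metric MeasureTheory
open scoped ENNReal

namespace RelaxedCLF

section Dynamics

variable {E : Type*} [NormedAddCommGroup E] [NormedSpace ℝ E]

/-- `x` solves the autonomous ODE `x' = F x` on the time set `I` and stays in the domain `D`. -/
def IsSolutionOn (F : E → E) (D : Set E) (x : ℝ → E) (I : Set ℝ) : Prop :=
  ∀ t ∈ I, x t ∈ D ∧ HasDerivWithinAt x (F (x t)) I t

/-- `O` is a (nontrivial) periodic orbit of `x' = F x` in `D`: the image of a nonconstant
periodic solution. -/
def IsPeriodicOrbit (F : E → E) (D : Set E) (O : Set E) : Prop :=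
  ∃ (x : ℝ → E) (T : ℝ), 0 < T ∧ IsSolutionOn F D x univ ∧ Function.Periodic x T ∧
    (∃ t, x t ≠ x 0) ∧ O = range x

/-- `O` is an exponentially stable periodic orbit of `x' = F x` in `D`: it is a periodic orbit, and
every initial state in `D` sufficiently close to `O` has a solution defined for all `t ≥ 0`, the
distance of which to `O` decays exponentially, at a uniform rate and in proportion to the initial
distance. -/
def IsExpStablePeriodicOrbit (F : E → E) (D : Set E) (O : Set E) : Prop :=
  IsPeriodicOrbit F D O ∧
    ∃ r N γ : ℝ, 0 < r ∧ 0 < N ∧ 0 < γ ∧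
      ∀ x₀ ∈ D, infDist x₀ O < r →
        (∃ x : ℝ → E, x 0 = x₀ ∧ IsSolutionOn F D x (Ici 0)) ∧
        ∀ x : ℝ → E, x 0 = x₀ → IsSolutionOn F D x (Ici 0) →
          ∀ t, 0 ≤ t → infDist (x t) O ≤ N * Real.exp (-γ * t) * infDist x₀ O

/-- `x` is a solution of `x' = F x` in `D` on the time interval `[0, T]`, `T > 0`, that starts
at distance less than `r` from `O`. -/
def IsTrajectoryNear (F : E → E) (D : Set E) (O : Set E) (r : ℝ) (x : ℝ → E) (T : ℝ) : Prop :=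
  0 < T ∧ IsSolutionOn F D x (Icc 0 T) ∧ infDist (x 0) O < r

end Dynamics

section Control

variable {E U G : Type*} [NormedAddCommGroup E] [NormedSpace ℝ E]
  [NormedAddCommGroup U] [NormedSpace ℝ U] [NormedAddCommGroup G] [NormedSpace ℝ G]

/-- The vector field of `η' = f(η) + g(η) μ`, `z' = p(η, z)` in closed loop with the state
feedback `μ = μ(η, z)`. -/
def closedLoop (f : E → E) (g : E → (U →L[ℝ] E)) (p : E → G → G) (μ : E → G → U) :
    E × G → E × G :=
  fun q => (f q.1 + g q.1 (μ q.1 q.2), p q.1 q.2)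

/-- The canonical embedding `ι₀ z = (0, z)`. -/
def iotaZero (z : G) : E × G := (0, z)

/-- `dV/dt (η, u) = L_f V(η) + L_g V(η) u`, the derivative of `V` along `η' = f(η) + g(η) u`. -/
noncomputable def VDot (f : E → E) (g : E → (U →L[ℝ] E)) (V : E → ℝ) (η : E) (u : U) : ℝ :=
  fderiv ℝ V η (f η) + fderiv ℝ V η (g η u)

/-- The scaled cumulative relaxation `w(t) = ∫₀ᵗ d(τ) / V(η(τ)) dτ`, with values in `[0, ∞]`. -/
noncomputable def cumulativeRelaxation (V : E → ℝ) (d : ℝ → ℝ) (η : ℝ → E) (t : ℝ) : ℝ≥0∞ :=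
  ∫⁻ τ in Icc 0 t, ENNReal.ofReal (d τ) / ENNReal.ofReal (V (η τ))

/-- The supremum of `w(t)`, over all times `t` and all trajectories `x = (η, z)` with `η(0) ≠ 0`
that start at distance less than `r` from `O`; `d x₀` is the relaxation, as a function of time,
on the trajectory with initial state `x₀`. -/
noncomputable def supRelaxation (F : E × G → E × G) (D : Set (E × G)) (O : Set (E × G)) (r : ℝ)
    (V : E → ℝ) (d : E × G → ℝ → ℝ) : ℝ≥0∞ :=
  ⨆ (x : ℝ → E × G) (t : ℝ) (_ : IsTrajectoryNear F D O r x t) (_ : (x 0).1 ≠ 0),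
    cumulativeRelaxation V (d (x 0)) (fun τ => (x τ).1) t

end Control

end RelaxedCLF

/-!
Write a closed-loop trajectory as `x = (η, z)`.

*Decay of `η`.* Where `η ≠ 0`, the relaxed inequality divided by `V` reads
`(log V)' ≤ -c₃ / ε + d / V`, so that `log V` decreases linearly up to the total relaxation
(`le_mul_exp_of_relaxed_deriv_le`). Finiteness of the latter also excludes that `η` leaves zero once
it has reached it, since `log V` would have to increase from `-∞`. The quadratic bounds on `V` turn
this into the estimate on `‖η‖` (`norm_fst_le_of_relaxed`). For `η(0) = 0` the relaxed inequality is
not assumed; continuous dependence on the initial state transfers the estimate from nearby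
trajectories with `η(0) ≠ 0` (`norm_fst_le_of_forall_ne_zero`). In particular `η = 0` is invariant
near the orbit, and solutions of the zero dynamics lift to solutions of the closed loop.

*Stability of the orbit.* No converse Lyapunov theorem is used. On a compact tube around the orbit
the closed loop agrees with a bounded, globally Lipschitz field, which is forward complete and has
Grönwall estimates. Over a fixed period `τ`, the closed loop therefore follows the lifted zero
dynamics up to a multiple of `‖η‖` (`infDist_le_of_zeroDynamics`). Take `τ` so long that the zero
dynamics contracts the distance to the orbit by a definite factor. The distances at the times `j τ`
then satisfy a contraction with an exponentially small error, because `η` decays from the initial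
time on; this keeps the trajectory in the tube and yields exponential decay
(`exp_decay_of_periodic_contraction`, `isExpStablePeriodicOrbit_of_transverse_decay`).
-/

namespace RelaxedCLF

open scoped NNReal Topology

/-! ### Solutions of locally Lipschitz autonomous equations -/

section Flow

variable {E : Type*} [NormedAddCommGroup E] [NormedSpace ℝ E]

lemma IsSolutionOn.continuousOn {F : E → E} {D : Set E} {x : ℝ → E} {I : Set ℝ}
    (h : IsSolutionOn F D x I) : ContinuousOn x I :=
  fun t ht => (h t ht).2.continuousWithinAt

lemma IsSolutionOn.mono {F : E → E} {D : Set E} {x : ℝ → E} {I J : Set ℝ}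
    (h : IsSolutionOn F D x I) (hJ : J ⊆ I) : IsSolutionOn F D x J :=
  fun t ht => ⟨(h t (hJ ht)).1, (h t (hJ ht)).2.mono hJ⟩

/-- A solution of one vector field solves every other one that agrees with it along the solution. -/
lemma IsSolutionOn.congr {F G : E → E} {D D' : Set E} {x : ℝ → E} {I : Set ℝ}
    (h : IsSolutionOn F D x I) (hmem : ∀ t ∈ I, x t ∈ D') (hFG : ∀ t ∈ I, F (x t) = G (x t)) :
    IsSolutionOn G D' x I :=
  fun t ht => ⟨hmem t ht, hFG t ht ▸ (h t ht).2⟩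

/-- Autonomous vector fields are invariant under time shifts. -/
lemma IsSolutionOn.comp_add_left {F : E → E} {D : Set E} {x : ℝ → E} {I J : Set ℝ} {s : ℝ}
    (h : IsSolutionOn F D x I) (hJ : ∀ t ∈ J, s + t ∈ I) :
    IsSolutionOn F D (fun t => x (s + t)) J := by
  intro t ht
  refine ⟨(h _ (hJ t ht)).1, ?_⟩
  have h2 : HasDerivWithinAt (fun u : ℝ => s + u) 1 J t :=
    ((hasDerivAt_id t).const_add s).hasDerivWithinAt
  simpa [Function.comp_def] using (h _ (hJ t ht)).2.scomp t h2 hJ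

/-- The radial retraction onto the ball of radius `M` is Lipschitz. -/
lemma lipschitzWith_radialRetraction {M : ℝ} (hM : 0 < M) :
    LipschitzWith 2 (fun u : E => (M / max M ‖u‖) • u) := by
  refine LipschitzWith.of_dist_le_mul fun u v => ?_
  have hab : |max M ‖v‖ - max M ‖u‖| ≤ ‖u - v‖ := by
    rw [max_comm M, max_comm M, norm_sub_rev]
    exact (abs_max_sub_max_le_abs _ _ _).trans (abs_norm_sub_norm_le v u)
  rw [dist_eq_norm, dist_eq_norm]
  have ha : 0 < max M ‖u‖ := lt_max_of_lt_left hM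
  have hb : 0 < max M ‖v‖ := lt_max_of_lt_left hM
  have h1 : M / max M ‖u‖ ≤ 1 := (div_le_one ha).2 (le_max_left _ _)
  have h2 : ‖v‖ / max M ‖v‖ ≤ 1 := (div_le_one hb).2 (le_max_right _ _)
  have hva : 0 ≤ ‖v‖ / max M ‖v‖ := by positivity
  have hMa : 0 ≤ M / max M ‖u‖ := by positivity
  generalize max M ‖u‖ = a at *
  generalize max M ‖v‖ = b at *
  have key : (M / a) • u - (M / b) • v = (M / a) • (u - v) + ((M / a) * ((b - a) / b)) • v := by
    have : M / a * ((b - a) / b) = M / a - M / b := by field_simp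
    rw [this, smul_sub, sub_smul]; abel
  calc ‖(M / a) • u - (M / b) • v‖
      ≤ (M / a) * ‖u - v‖ + (M / a) * (|b - a| * (‖v‖ / b)) := by
        rw [key]
        refine (norm_add_le _ _).trans_eq ?_
        rw [norm_smul, norm_smul, Real.norm_of_nonneg hMa, norm_mul, Real.norm_of_nonneg hMa,
          norm_div, Real.norm_of_nonneg hb.le, Real.norm_eq_abs]
        ring
    _ ≤ 1 * ‖u - v‖ + 1 * (‖u - v‖ * 1) := by gcongr
    _ = (2 : ℝ≥0) * ‖u - v‖ := by push_cast; ring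

/-- A vector field that is Lipschitz on a compact set agrees there with one that is bounded and
globally Lipschitz; this reduces local questions about flows to complete flows. -/
lemma exists_lipschitzWith_bounded_eqOn [FiniteDimensional ℝ E] {F : E → E} {K : Set E}
    (hK : IsCompact K) {C : ℝ≥0} (hF : LipschitzOnWith C F K) :
    ∃ (L M : ℝ≥0) (G : E → E), LipschitzWith L G ∧ (∀ x, ‖G x‖ ≤ M) ∧ EqOn F G K := by
  obtain ⟨G₀, hG₀, hE⟩ := hF.extend_finite_dimension
  obtain ⟨M, hM⟩ := hK.exists_bound_of_continuousOn hF.continuousOn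
  set M' : ℝ := max M 1
  have hM' : 0 < M' := lt_max_of_lt_right one_pos
  refine ⟨_, ⟨M', hM'.le⟩, _, (lipschitzWith_radialRetraction hM').comp hG₀, fun x => ?_,
    fun x hx => ?_⟩
  · have ha : 0 < max M' ‖G₀ x‖ := lt_max_of_lt_left hM'
    simp only [Function.comp, norm_smul]
    rw [Real.norm_of_nonneg (by positivity), div_mul_eq_mul_div, div_le_iff₀ ha]
    exact mul_le_mul_of_nonneg_left (le_max_right _ _) hM'.le
  · have : ‖G₀ x‖ ≤ M' := by rw [← hE hx]; exact (hM x hx).trans (le_max_left _ _)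
    simp [Function.comp, max_eq_left this, hM'.ne', hE hx]

/-- Grönwall estimate: two solutions of a globally Lipschitz field diverge at most exponentially. -/
lemma dist_le_of_isSolutionOn {G : E → E} {L : ℝ≥0} (hG : LipschitzWith L G) {D D' : Set E}
    {x y : ℝ → E} {T : ℝ} (hx : IsSolutionOn G D x (Icc 0 T)) (hy : IsSolutionOn G D' y (Icc 0 T))
    {t : ℝ} (ht : t ∈ Icc 0 T) : dist (x t) (y t) ≤ dist (x 0) (y 0) * Real.exp (L * t) := by
  have aux : ∀ {D : Set E} {x : ℝ → E}, IsSolutionOn G D x (Icc 0 T) →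
      ∀ t ∈ Ico 0 T, HasDerivWithinAt x (G (x t)) (Ici t) t := fun {D x} hx t ht =>
    ((hx t ⟨ht.1, ht.2.le⟩).2).mono_of_mem_nhdsWithin (Icc_mem_nhdsGE_of_mem ht)
  simpa using dist_le_of_trajectories_ODE (v := fun _ => G) (fun _ => hG) hx.continuousOn (aux hx)
    hy.continuousOn (aux hy) le_rfl t ht

/-- A bounded globally Lipschitz vector field is forward complete. -/
lemma exists_isSolutionOn_Ici [CompleteSpace E] {G : E → E} {L M : ℝ≥0} (hG : LipschitzWith L G)
    (hM : ∀ x, ‖G x‖ ≤ M) (x₀ : E) : ∃ x : ℝ → E, x 0 = x₀ ∧ IsSolutionOn G univ x (Ici 0) := by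
  have fin : ∀ n : ℕ, ∃ x : ℝ → E, x 0 = x₀ ∧ IsSolutionOn G univ x (Icc 0 (n + 1 : ℝ)) := by
    intro n
    have h0 : (0 : ℝ) ∈ Icc (0 : ℝ) (n + 1) := ⟨le_rfl, by positivity⟩
    have hPL : IsPicardLindelof (fun _ : ℝ => G) (⟨0, h0⟩ : Icc (0 : ℝ) (n + 1)) x₀
        (M * (n + 1)) 0 M L :=
      { lipschitzOnWith := fun _ _ => hG.lipschitzOnWith
        continuousOn := fun _ _ => continuousOn_const
        norm_le := fun _ _ x _ => hM x
        mul_max_le := by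
          simp only [sub_zero, sub_self]
          rw [max_eq_left h0.2]; push_cast; simp }
    obtain ⟨x, hx0, hx⟩ := hPL.exists_eq_forall_mem_Icc_hasDerivWithinAt₀
    exact ⟨x, hx0, fun t ht => ⟨mem_univ _, hx t ht⟩⟩
  choose Y hY0 hY using fin
  -- any two of the finite-time solutions agree where both are defined
  have agree : ∀ (n : ℕ) (s : ℝ), s ∈ Icc 0 (n + 1 : ℝ) → Y ⌊s⌋₊ s = Y n s := by
    intro n s hs
    have hs' : s ∈ Icc 0 (min (⌊s⌋₊ + 1 : ℝ) (n + 1)) :=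
      ⟨hs.1, le_min (Nat.lt_floor_add_one s).le hs.2⟩
    have := dist_le_of_isSolutionOn hG
      ((hY ⌊s⌋₊).mono (Icc_subset_Icc_right (min_le_left _ (n + 1 : ℝ))))
      ((hY n).mono (Icc_subset_Icc_right (min_le_right (⌊s⌋₊ + 1 : ℝ) _))) hs'
    rw [hY0, hY0, dist_self, zero_mul] at this
    exact dist_le_zero.1 this
  refine ⟨fun s => Y ⌊s⌋₊ s, by simp [hY0], fun t ht => ⟨mem_univ _, ?_⟩⟩
  have ht' : t ∈ Icc 0 (⌊t⌋₊ + 1 : ℝ) := ⟨ht, (Nat.lt_floor_add_one t).le⟩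
  have hd := (hY ⌊t⌋₊ t ht').2.congr (fun s hs => agree ⌊t⌋₊ s hs) rfl
  refine hd.mono_of_mem_nhdsWithin ?_
  have : Iio (⌊t⌋₊ + 1 : ℝ) ∈ 𝓝[Ici 0] t :=
    mem_nhdsWithin_of_mem_nhds (Iio_mem_nhds (Nat.lt_floor_add_one t))
  filter_upwards [this, self_mem_nhdsWithin] with s h1 h2 using ⟨h2, le_of_lt h1⟩

/-- Uniqueness of solutions on `[0, T]` for a field that is Lipschitz on compact sets. -/
lemma IsSolutionOn.eqOn [FiniteDimensional ℝ E] {F : E → E} {D : Set E}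
    (hF : ∀ K ⊆ D, IsCompact K → ∃ C, LipschitzOnWith C F K)
    {x y : ℝ → E} {T : ℝ} (hx : IsSolutionOn F D x (Icc 0 T)) (hy : IsSolutionOn F D y (Icc 0 T))
    (h0 : x 0 = y 0) : EqOn x y (Icc 0 T) := by
  have hK : IsCompact (x '' Icc 0 T ∪ y '' Icc 0 T) :=
    (isCompact_Icc.image_of_continuousOn hx.continuousOn).union
      (isCompact_Icc.image_of_continuousOn hy.continuousOn)
  obtain ⟨C, hC⟩ := hF _ (union_subset (image_subset_iff.2 fun t ht => (hx t ht).1)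
    (image_subset_iff.2 fun t ht => (hy t ht).1)) hK
  obtain ⟨L, M, G, hG, -, hFG⟩ := exists_lipschitzWith_bounded_eqOn hK hC
  intro t ht
  have := dist_le_of_isSolutionOn hG
    (hx.congr (D' := univ) (fun _ _ => mem_univ _) fun s hs => hFG (.inl (mem_image_of_mem x hs)))
    (hy.congr (D' := univ) (fun _ _ => mem_univ _) fun s hs => hFG (.inr (mem_image_of_mem y hs))) ht
  rw [h0, dist_self, zero_mul] at this
  exact dist_le_zero.1 this

/-- Continuous dependence on the initial state: near a solution on `[0, T]`, solutions from all
nearby initial states exist on `[0, T]` and diverge at most by a fixed factor. -/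
lemma IsSolutionOn.exists_nearby [FiniteDimensional ℝ E] {F : E → E} {D : Set E} (hD : IsOpen D)
    (hF : ∀ K ⊆ D, IsCompact K → ∃ C, LipschitzOnWith C F K)
    {x : ℝ → E} {T : ℝ} (hx : IsSolutionOn F D x (Icc 0 T)) :
    ∃ ρ > 0, ∃ B : ℝ, ∀ y₀, dist y₀ (x 0) < ρ → ∃ y : ℝ → E, y 0 = y₀ ∧
      IsSolutionOn F D y (Icc 0 T) ∧ ∀ t ∈ Icc 0 T, dist (y t) (x t) ≤ dist y₀ (x 0) * B := by
  have : ProperSpace E := FiniteDimensional.proper ℝ E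
  have hK : IsCompact (x '' Icc 0 T) := isCompact_Icc.image_of_continuousOn hx.continuousOn
  obtain ⟨δ, hδ, hδD⟩ := hK.exists_cthickening_subset_open hD
    (image_subset_iff.2 fun t ht => (hx t ht).1)
  obtain ⟨C, hC⟩ := hF _ hδD hK.cthickening
  obtain ⟨L, M, G, hG, hM, hFG⟩ := exists_lipschitzWith_bounded_eqOn hK.cthickening hC
  have hxG : IsSolutionOn G univ x (Icc 0 T) := hx.congr (fun _ _ => mem_univ _) fun t ht =>
    hFG (self_subset_cthickening _ (mem_image_of_mem x ht))
  refine ⟨δ / Real.exp (L * T), by positivity, Real.exp (L * T), fun y₀ hy₀ => ?_⟩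
  obtain ⟨y, hy0, hy⟩ := exists_isSolutionOn_Ici hG hM y₀
  have hy' : IsSolutionOn G univ y (Icc 0 T) := hy.mono Icc_subset_Ici_self
  have hdist : ∀ t ∈ Icc 0 T, dist (y t) (x t) ≤ dist y₀ (x 0) * Real.exp (L * T) := by
    intro t ht
    refine (dist_le_of_isSolutionOn hG hy' hxG ht).trans ?_
    rw [hy0]
    gcongr
    exact ht.2
  have htube : ∀ t ∈ Icc 0 T, y t ∈ cthickening δ (x '' Icc 0 T) := fun t ht =>
    mem_cthickening_of_dist_le _ _ _ _ (mem_image_of_mem x ht)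
      ((hdist t ht).trans ((lt_div_iff₀ (by positivity)).1 hy₀).le)
  exact ⟨y, hy0, hy'.congr (fun t ht => hδD (htube t ht)) (fun t ht => (hFG (htube t ht)).symm),
    hdist⟩

end Flow

/-! ### Comparison lemma for the relaxed Lyapunov inequality -/

section Relaxed

/-- Integrated form of `(log v)' ≤ -κ + d / v` on an interval where `v` is positive. -/
lemma le_mul_exp_of_relaxed_deriv_le_of_pos {v v' d : ℝ → ℝ} {a b κ : ℝ} {W : ℝ≥0∞} (hab : a ≤ b)
    (hv : ∀ t ∈ Icc a b, 0 < v t) (hv' : ∀ t ∈ Icc a b, HasDerivWithinAt v (v' t) (Icc a b) t)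
    (hdm : Measurable d) (hd : ∀ t ∈ Icc a b, 0 ≤ d t)
    (hrel : ∀ t ∈ Icc a b, v' t + κ * v t ≤ d t) (hW : W ≠ ⊤)
    (hdW : ∫⁻ t in Icc a b, ENNReal.ofReal (d t) / ENNReal.ofReal (v t) ≤ W) :
    v b ≤ v a * Real.exp (W.toReal - κ * (b - a)) := by
  have hvc : ContinuousOn v (Icc a b) := fun t ht => (hv' t ht).continuousWithinAt
  have hlint : ∫⁻ t in Icc a b, ENNReal.ofReal (d t / v t) ≤ W := by
    refine le_of_eq_of_le (setLIntegral_congr_fun measurableSet_Icc fun t ht => ?_) hdW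
    exact ENNReal.ofReal_div_of_pos (hv t ht)
  have hnn : ∀ᵐ t ∂volume.restrict (Icc a b), 0 ≤ d t / v t :=
    (ae_restrict_iff' measurableSet_Icc).2 (.of_forall fun t ht => div_nonneg (hd t ht) (hv t ht).le)
  have hmeas : AEStronglyMeasurable (fun t => d t / v t) (volume.restrict (Icc a b)) :=
    (hdm.aemeasurable.div (hvc.aemeasurable measurableSet_Icc)).aestronglyMeasurable
  have hint : IntegrableOn (fun t => d t / v t) (Icc a b) := by
    refine ⟨hmeas, ?_⟩
    rw [hasFiniteIntegral_iff_ofReal hnn]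
    exact hlint.trans_lt hW.lt_top
  have hintW : ∫ t in a..b, d t / v t ≤ W.toReal := by
    rw [intervalIntegral.integral_of_le hab, ← integral_Icc_eq_integral_Ioc,
      integral_eq_lintegral_of_nonneg_ae hnn hmeas]
    exact ENNReal.toReal_mono hW hlint
  have hconst : IntegrableOn (fun _ : ℝ => κ) (Icc a b) := by simp
  have hlog := intervalIntegral.sub_le_integral_of_hasDeriv_right_of_le
    (g := fun t => Real.log (v t)) (g' := fun t => v' t / v t) (φ := fun t => d t / v t - κ) hab
    (hvc.log fun t ht => (hv t ht).ne')
    (fun t ht => by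
      have ht' : t ∈ Icc a b := Ioo_subset_Icc_self ht
      exact (((hv' t ht').log (hv t ht').ne').hasDerivAt (Icc_mem_nhds ht.1 ht.2)).hasDerivWithinAt)
    (hint.sub hconst)
    (fun t ht => by
      have ht' : t ∈ Icc a b := Ioo_subset_Icc_self ht
      rw [le_sub_iff_add_le, ← mul_div_cancel_right₀ κ (hv t ht').ne', ← add_div]
      exact div_le_div_of_nonneg_right (hrel t ht') (hv t ht').le)
  have hi : IntervalIntegrable (fun t => d t / v t) volume a b :=
    (intervalIntegrable_iff_integrableOn_Icc_of_le hab).2 hint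
  rw [intervalIntegral.integral_sub hi (by simp), intervalIntegral.integral_const, smul_eq_mul]
    at hlog
  have hva := hv a (left_mem_Icc.2 hab)
  have hvb := hv b (right_mem_Icc.2 hab)
  rw [← Real.exp_log hva, ← Real.exp_add, ← Real.log_le_iff_le_exp hvb]
  linarith

/-- Comparison lemma behind the relaxed Lyapunov inequality. Finiteness of the integral of `d / v`
prevents `v` from becoming positive again once it has vanished: `log v` would have to grow by an
infinite amount. -/
lemma le_mul_exp_of_relaxed_deriv_le {v v' d : ℝ → ℝ} {T κ : ℝ} {W : ℝ≥0∞}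
    (hv : ∀ t ∈ Icc 0 T, 0 ≤ v t) (hv' : ∀ t ∈ Icc 0 T, HasDerivWithinAt v (v' t) (Icc 0 T) t)
    (hdm : Measurable d) (hd : ∀ t ∈ Icc 0 T, 0 ≤ d t)
    (hrel : ∀ t ∈ Icc 0 T, v' t + κ * v t ≤ d t) (hW : W ≠ ⊤)
    (hdW : ∫⁻ t in Icc 0 T, ENNReal.ofReal (d t) / ENNReal.ofReal (v t) ≤ W)
    {t : ℝ} (ht : t ∈ Icc 0 T) : v t ≤ v 0 * Real.exp (W.toReal - κ * t) := by
  have hvc : ContinuousOn v (Icc 0 T) := fun t ht => (hv' t ht).continuousWithinAt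
  have h0 : (0 : ℝ) ∈ Icc 0 T := ⟨le_rfl, ht.1.trans ht.2⟩
  have main : ∀ s ∈ Icc 0 t, (∀ u ∈ Icc s t, 0 < v u) →
      v t ≤ v s * Real.exp (W.toReal - κ * (t - s)) := by
    intro s hs hpos
    have hsub : Icc s t ⊆ Icc 0 T := Icc_subset_Icc hs.1 ht.2
    exact le_mul_exp_of_relaxed_deriv_le_of_pos hs.2 hpos
      (fun u hu => (hv' u (hsub hu)).mono hsub) hdm (fun u hu => hd u (hsub hu))
      (fun u hu => hrel u (hsub hu)) hW ((lintegral_mono_set hsub).trans hdW)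
  rcases (hv t ht).eq_or_lt with hvt | hvt
  · rw [← hvt]; exact mul_nonneg (hv 0 h0) (Real.exp_pos _).le
  by_cases hz : ∃ s ∈ Icc 0 t, v s = 0
  · exfalso
    -- the last zero `a` of `v` before `t`
    set S : Set ℝ := Icc 0 t ∩ v ⁻¹' {0}
    have hSc : IsCompact S := isCompact_Icc.of_isClosed_subset
      ((hvc.mono (Icc_subset_Icc_right ht.2)).preimage_isClosed_of_isClosed isClosed_Icc
        isClosed_singleton) inter_subset_left
    obtain ⟨a, ⟨⟨ha0, hat⟩, hva⟩, hmax⟩ := hSc.exists_isGreatest hz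
    have hva : v a = 0 := hva
    have hat' : a < t := hat.lt_of_ne fun h => hvt.ne' (h ▸ hva)
    have hle : ∀ s ∈ Ioo a t, v t ≤ v s * Real.exp (W.toReal - κ * (t - s)) := by
      intro s hs
      refine main s ⟨ha0.trans hs.1.le, hs.2.le⟩ fun u hu => ?_
      have hau : a < u := hs.1.trans_le hu.1
      exact (hv u ⟨ha0.trans hau.le, hu.2.trans ht.2⟩).lt_of_ne fun h =>
        hau.not_ge (hmax ⟨⟨ha0.trans hau.le, hu.2⟩, h.symm⟩)
    have hlim : Filter.Tendsto (fun s => v s * Real.exp (W.toReal - κ * (t - s))) (𝓝[Ioo a t] a)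
        (𝓝 (v a * Real.exp (W.toReal - κ * (t - a)))) :=
      ((hvc a ⟨ha0, hat.trans ht.2⟩).mono
        (Ioo_subset_Icc_self.trans (Icc_subset_Icc ha0 ht.2))).mul
        (Continuous.continuousWithinAt (by fun_prop))
    have : (𝓝[Ioo a t] a).NeBot := by rw [nhdsWithin_Ioo_eq_nhdsGT hat']; infer_instance
    have h := ge_of_tendsto hlim (eventually_mem_nhdsWithin.mono hle)
    rw [hva, zero_mul] at h
    exact hvt.not_ge h
  · push Not at hz
    simpa using main 0 ⟨le_rfl, ht.1⟩ fun u hu =>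
      (hv u ⟨hu.1, hu.2.trans ht.2⟩).lt_of_ne (hz u hu).symm

end Relaxed

/-! ### Local existence, periodic orbits -/

section Flow

variable {E : Type*} [NormedAddCommGroup E] [NormedSpace ℝ E]

lemma exists_isSolutionOn_Icc [FiniteDimensional ℝ E] {F : E → E} {D : Set E} (hD : IsOpen D)
    (hF : ∀ K ⊆ D, IsCompact K → ∃ C, LipschitzOnWith C F K) {x₀ : E} (hx₀ : x₀ ∈ D) :
    ∃ (x : ℝ → E) (T : ℝ), 0 < T ∧ x 0 = x₀ ∧ IsSolutionOn F D x (Icc 0 T) := by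
  have : ProperSpace E := FiniteDimensional.proper ℝ E
  obtain ⟨δ, hδ, hδD⟩ := nhds_basis_closedBall.mem_iff.1 (hD.mem_nhds hx₀)
  obtain ⟨C, hC⟩ := hF _ hδD (isCompact_closedBall x₀ δ)
  obtain ⟨L, M, G, hG, hM, hFG⟩ := exists_lipschitzWith_bounded_eqOn (isCompact_closedBall x₀ δ) hC
  obtain ⟨y, hy0, hy⟩ := exists_isSolutionOn_Ici hG hM x₀
  have hcont : Filter.Tendsto y (𝓝[≥] 0) (𝓝 x₀) := hy0 ▸ hy.continuousOn 0 self_mem_Ici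
  obtain ⟨T, hT, hsub⟩ := mem_nhdsGE_iff_exists_Icc_subset.1 (hcont (closedBall_mem_nhds x₀ hδ))
  exact ⟨y, T, hT, hy0, (hy.mono Icc_subset_Ici_self).congr (fun t ht => hδD (hsub ht))
    fun t ht => (hFG (hsub ht)).symm⟩

lemma IsPeriodicOrbit.isCompact {F : E → E} {D O : Set E} (h : IsPeriodicOrbit F D O) :
    IsCompact O := by
  obtain ⟨x, T, hT, hx, hper, -, rfl⟩ := h
  rw [← hper.image_Icc hT 0]
  exact isCompact_Icc.image_of_continuousOn (hx.continuousOn.mono (subset_univ _))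

lemma IsPeriodicOrbit.subset {F : E → E} {D O : Set E} (h : IsPeriodicOrbit F D O) : O ⊆ D := by
  obtain ⟨x, T, -, hx, -, -, rfl⟩ := h
  exact range_subset_iff.2 fun t => (hx t (mem_univ t)).1

lemma IsPeriodicOrbit.nonempty {F : E → E} {D O : Set E} (h : IsPeriodicOrbit F D O) :
    O.Nonempty := by
  obtain ⟨x, T, -, -, -, -, rfl⟩ := h
  exact range_nonempty x

end Flow

/-! ### Orbital stability from transverse decay -/

section Lift

variable {E G : Type*} [NormedAddCommGroup E] [NormedAddCommGroup G]

lemma isometry_iotaZero : Isometry (iotaZero : G → E × G) :=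
  Isometry.of_dist_eq fun a b => by simp [iotaZero, Prod.dist_eq]

lemma infDist_iotaZero (z : G) (OZ : Set G) :
    infDist (iotaZero z : E × G) (iotaZero '' OZ) = infDist z OZ :=
  infDist_image isometry_iotaZero

lemma infDist_snd_le {OZ : Set G} (hne : OZ.Nonempty) (q : E × G) :
    infDist q.2 OZ ≤ infDist q (iotaZero '' OZ) := by
  refine (le_infDist (hne.image _)).2 ?_
  rintro _ ⟨z, hz, rfl⟩
  exact (infDist_le_dist_of_mem hz).trans (le_max_right _ _)

lemma norm_fst_le_infDist {OZ : Set G} (hne : OZ.Nonempty) (q : E × G) :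
    ‖q.1‖ ≤ infDist q (iotaZero '' OZ) := by
  refine (le_infDist (hne.image _)).2 ?_
  rintro _ ⟨z, hz, rfl⟩
  rw [← dist_zero_right]
  exact le_max_left _ _

variable [NormedSpace ℝ E] [NormedSpace ℝ G]

/-- Where the transverse component of the field vanishes, solutions of the zero dynamics lift to
solutions of the full system. -/
lemma IsSolutionOn.iotaZero {F : E × G → E × G} {X : Set E} {Z : Set G} (h0 : (0 : E) ∈ X)
    {z : ℝ → G} {I : Set ℝ} (hz : IsSolutionOn (fun z => (F (0, z)).2) Z z I)
    (hF : ∀ t ∈ I, (F (0, z t)).1 = 0) :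
    IsSolutionOn F (X ×ˢ Z) (fun t => RelaxedCLF.iotaZero (z t)) I := by
  intro t ht
  refine ⟨⟨h0, (hz t ht).1⟩, ?_⟩
  have h := (hasDerivWithinAt_const t I (0 : E)).prodMk (hz t ht).2
  have e : F (0, z t) = (0, (F (0, z t)).2) := Prod.ext (hF t ht) rfl
  rw [← e] at h
  exact h

end Lift

section Stability

variable {E G : Type*} [NormedAddCommGroup E] [NormedSpace ℝ E] [NormedAddCommGroup G]
  [NormedSpace ℝ G]

/-- A bound on `‖η(t)‖` in proportion to `‖η(0)‖` makes `η = 0` invariant, so the transverse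
component of the field vanishes there. -/
lemma fst_eq_zero_of_transverse_decay [FiniteDimensional ℝ E] [FiniteDimensional ℝ G]
    {F : E × G → E × G} {D : Set (E × G)} (hD : IsOpen D)
    (hF : ∀ K ⊆ D, IsCompact K → ∃ C, LipschitzOnWith C F K) {O : Set (E × G)} {r M lam : ℝ}
    (hdecay : ∀ x T, IsTrajectoryNear F D O r x T → ∀ t ∈ Icc 0 T,
      ‖(x t).1‖ ≤ M * Real.exp (-lam * t) * ‖(x 0).1‖)
    {z : G} (hz : ((0, z) : E × G) ∈ D) (hr : infDist ((0, z) : E × G) O < r) :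
    (F (0, z)).1 = 0 := by
  obtain ⟨x, T, hT, hx0, hx⟩ := exists_isSolutionOn_Icc hD hF hz
  have hzero : ∀ t ∈ Icc 0 T, (x t).1 = 0 := fun t ht => by
    simpa [hx0] using hdecay x T ⟨hT, hx, by rwa [hx0]⟩ t ht
  have h0 : (0 : ℝ) ∈ Icc 0 T := ⟨le_rfl, hT.le⟩
  have h1 : HasDerivWithinAt (fun t => (x t).1) (F (x 0)).1 (Icc 0 T) 0 := (hx 0 h0).2.fst
  have h2 : HasDerivWithinAt (fun t => (x t).1) 0 (Icc 0 T) 0 :=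
    (hasDerivWithinAt_const 0 (Icc 0 T) (0 : E)).congr hzero (hzero 0 h0)
  rw [← hx0]
  exact (uniqueDiffOn_Icc hT 0 h0).eq_deriv _ h1 h2

/-- One comparison step: over time `t`, the flow of a globally Lipschitz field `H` follows the
lifted zero dynamics up to an error proportional to the transverse deviation. -/
lemma infDist_le_of_zeroDynamics {H : E × G → E × G} {L : ℝ≥0} (hH : LipschitzWith L H)
    {P : G → G} {Z OZ : Set G} (hne : OZ.Nonempty) {r₀ N γ ρ : ℝ} (hN : 0 < N) (hγ : 0 < γ)
    (hex : ∀ z₀ ∈ Z, infDist z₀ OZ < r₀ → ∃ z : ℝ → G, z 0 = z₀ ∧ IsSolutionOn P Z z (Ici 0))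
    (hst : ∀ z₀ ∈ Z, infDist z₀ OZ < r₀ → ∀ z : ℝ → G, z 0 = z₀ → IsSolutionOn P Z z (Ici 0) →
      ∀ t, 0 ≤ t → infDist (z t) OZ ≤ N * Real.exp (-γ * t) * infDist z₀ OZ)
    (hlift : ∀ z : ℝ → G, IsSolutionOn P Z z (Ici 0) → (∀ t, 0 ≤ t → infDist (z t) OZ ≤ ρ) →
      IsSolutionOn H univ (fun t => (iotaZero (z t) : E × G)) (Ici 0))
    {y : ℝ → E × G} (hy : IsSolutionOn H univ y (Ici 0)) {s : ℝ} (hs : 0 ≤ s)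
    (hsZ : (y s).2 ∈ Z) (hsr : infDist (y s) (iotaZero '' OZ) < r₀)
    (hsρ : N * infDist (y s) (iotaZero '' OZ) ≤ ρ) {t : ℝ} (ht : 0 ≤ t) :
    infDist (y (s + t)) (iotaZero '' OZ) ≤
      N * Real.exp (-γ * t) * infDist (y s) (iotaZero '' OZ) + Real.exp (L * t) * ‖(y s).1‖ := by
  have hle := infDist_snd_le hne (y s)
  obtain ⟨z, hz0, hz⟩ := hex _ hsZ (hle.trans_lt hsr)
  have hzd := hst _ hsZ (hle.trans_lt hsr) z hz0 hz
  have hexp : ∀ t : ℝ, 0 ≤ t → Real.exp (-γ * t) ≤ 1 := fun t ht =>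
    Real.exp_le_one_iff.2 (by nlinarith)
  have hzρ : ∀ t, 0 ≤ t → infDist (z t) OZ ≤ ρ := fun t ht =>
    calc infDist (z t) OZ ≤ N * Real.exp (-γ * t) * infDist (y s).2 OZ := hzd t ht
      _ ≤ N * 1 * infDist (y s) (iotaZero '' OZ) := by
        gcongr
        · exact infDist_nonneg
        · exact hexp t ht
      _ ≤ ρ := by rwa [mul_one]
  have hy' : IsSolutionOn H univ (fun u => y (s + u)) (Icc 0 t) :=
    hy.comp_add_left fun u hu => add_nonneg hs hu.1
  have hd := dist_le_of_isSolutionOn hH hy' ((hlift z hz hzρ).mono Icc_subset_Ici_self)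
    (right_mem_Icc.2 ht)
  have hd0 : dist (y (s + 0)) (iotaZero (z 0) : E × G) = ‖(y s).1‖ := by
    simp [hz0, iotaZero, Prod.dist_eq]
  rw [hd0] at hd
  calc infDist (y (s + t)) (iotaZero '' OZ)
      ≤ infDist (iotaZero (z t) : E × G) (iotaZero '' OZ) + dist (y (s + t)) (iotaZero (z t)) :=
        infDist_le_infDist_add_dist
    _ ≤ N * Real.exp (-γ * t) * infDist (y s) (iotaZero '' OZ) + Real.exp (L * t) * ‖(y s).1‖ := by
        rw [infDist_iotaZero, mul_comm (Real.exp (L * t))]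
        refine add_le_add ((hzd t ht).trans ?_) hd
        gcongr

/-- Discrete-time contraction: if, as long as the deviation `Δ` stays below `ρ`, it is contracted
over each period `τ` by the factor `N e^{-γ τ} ≤ e^{-κ τ} / 2` up to an error `C e^{-κ j τ} δ`,
then it stays below `ρ` and decays at the rate `κ`. -/
lemma exp_decay_of_periodic_contraction {Δ : ℝ → ℝ} {N γ κ C δ ρ τ B : ℝ} (hτ : 0 < τ)
    (hN : 0 < N) (hγ : 0 < γ) (hκ : 0 < κ) (hC : 0 ≤ C) (hδ : 0 ≤ δ) (hΔ : ∀ t, 0 ≤ Δ t)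
    (hq : N * Real.exp (-γ * τ) ≤ Real.exp (-κ * τ) / 2)
    (hB1 : 1 ≤ B) (hBC : 2 * C ≤ B * Real.exp (-κ * τ)) (hAρ : (N * B + C) * δ ≤ ρ)
    (hδρ : δ ≤ ρ) (h0 : Δ 0 ≤ δ)
    (hstep : ∀ j : ℕ, (∀ t ∈ Icc 0 (j * τ), Δ t ≤ ρ) → Δ (j * τ) ≤ B * δ → ∀ t ∈ Icc 0 τ,
      Δ (j * τ + t) ≤ N * Real.exp (-γ * t) * Δ (j * τ) + C * (Real.exp (-κ * τ) ^ j * δ)) :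
    ∀ t, 0 ≤ t → Δ t ≤ ρ ∧
      Δ t ≤ (N * B + C) * Real.exp (κ * τ) * Real.exp (-κ * t) * δ := by
  set θ := Real.exp (-κ * τ) with hθ
  have hθ0 : 0 < θ := Real.exp_pos _
  have hθ1 : θ ≤ 1 := Real.exp_le_one_iff.2 (by nlinarith)
  have hB : 0 < B := one_pos.trans_le hB1
  have hpow : ∀ j : ℕ, θ ^ j * δ ≤ δ := fun j =>
    mul_le_of_le_one_left hδ (pow_le_one₀ hθ0.le hθ1)
  -- the bound within the period that follows a time `j τ` at which the estimate holds
  have within : ∀ j : ℕ, (∀ t ∈ Icc 0 (j * τ), Δ t ≤ ρ) → Δ (j * τ) ≤ B * (θ ^ j * δ) →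
      ∀ t ∈ Icc 0 τ, Δ (j * τ + t) ≤ (N * B + C) * (θ ^ j * δ) := by
    intro j hj hjB t ht
    refine (hstep j hj (hjB.trans (mul_le_mul_of_nonneg_left (hpow j) hB.le)) t ht).trans ?_
    have hexp : Real.exp (-γ * t) ≤ 1 := Real.exp_le_one_iff.2 (by nlinarith [ht.1])
    calc N * Real.exp (-γ * t) * Δ (j * τ) + C * (θ ^ j * δ)
        ≤ N * 1 * (B * (θ ^ j * δ)) + C * (θ ^ j * δ) := by
          gcongr
          exact hΔ _
      _ = (N * B + C) * (θ ^ j * δ) := by ring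
  have claim : ∀ j : ℕ, (∀ t ∈ Icc 0 (j * τ), Δ t ≤ ρ) ∧ Δ (j * τ) ≤ B * (θ ^ j * δ) := by
    intro j
    induction j with
    | zero =>
      refine ⟨fun t ht => ?_, ?_⟩
      · have : t = 0 := le_antisymm (by simpa using ht.2) ht.1
        exact this ▸ h0.trans hδρ
      · simpa using h0.trans (le_mul_of_one_le_left hδ hB1)
    | succ j ih =>
      obtain ⟨ih1, ih2⟩ := ih
      have hsucc : ((j + 1 : ℕ) : ℝ) * τ = j * τ + τ := by push_cast; ring
      rw [hsucc]
      constructor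
      · intro t ht
        rcases le_total t (j * τ) with h | h
        · exact ih1 t ⟨ht.1, h⟩
        · have := within j ih1 ih2 (t - j * τ) ⟨by linarith, by linarith [ht.2]⟩
          rw [add_sub_cancel] at this
          refine this.trans (le_trans ?_ hAρ)
          exact mul_le_mul_of_nonneg_left (hpow j) (by positivity)
      · refine (hstep j ih1 (ih2.trans (mul_le_mul_of_nonneg_left (hpow j) hB.le)) τ
          ⟨hτ.le, le_rfl⟩).trans ?_
        calc N * Real.exp (-γ * τ) * Δ (j * τ) + C * (θ ^ j * δ)
            ≤ θ / 2 * (B * (θ ^ j * δ)) + B * θ / 2 * (θ ^ j * δ) := by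
              gcongr
              · exact hΔ _
              · linarith
          _ = B * (θ ^ (j + 1) * δ) := by ring
  intro t ht
  set j := ⌊t / τ⌋₊
  have hj1 : j * τ ≤ t := (le_div_iff₀ hτ).1 (Nat.floor_le (div_nonneg ht hτ.le))
  have hj2 : t ≤ j * τ + τ := by
    have := (div_lt_iff₀ hτ).1 (Nat.lt_floor_add_one (t / τ))
    linarith
  have hw := within j (claim j).1 (claim j).2 (t - j * τ) ⟨by linarith, by linarith⟩
  rw [add_sub_cancel] at hw
  refine ⟨(hw.trans (mul_le_mul_of_nonneg_left (hpow j) (by positivity))).trans hAρ,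
    hw.trans ?_⟩
  have hθj : θ ^ j ≤ Real.exp (κ * τ) * Real.exp (-κ * t) := by
    rw [hθ, ← Real.exp_nat_mul, ← Real.exp_add, Real.exp_le_exp]
    nlinarith
  calc (N * B + C) * (θ ^ j * δ)
      ≤ (N * B + C) * (Real.exp (κ * τ) * Real.exp (-κ * t) * δ) := by gcongr
    _ = _ := by ring

/-- Exponential decay of the transverse component, along all trajectories that start near the
lifted orbit, transfers exponential stability of the orbit from the zero dynamics to the full
system. -/
theorem isExpStablePeriodicOrbit_of_transverse_decay [FiniteDimensional ℝ E]
    [FiniteDimensional ℝ G] {F : E × G → E × G} {X : Set E} {Z : Set G} (hX : IsOpen X)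
    (hZ : IsOpen Z) (hX0 : (0 : E) ∈ X)
    (hF : ∀ K ⊆ X ×ˢ Z, IsCompact K → ∃ C, LipschitzOnWith C F K) {OZ : Set G}
    (hOZ : IsExpStablePeriodicOrbit (fun z => (F (0, z)).2) Z OZ) {r M lam : ℝ} (hr : 0 < r)
    (hlam : 0 < lam)
    (hdecay : ∀ x T, IsTrajectoryNear F (X ×ˢ Z) (iotaZero '' OZ) r x T → ∀ t ∈ Icc 0 T,
      ‖(x t).1‖ ≤ M * Real.exp (-lam * t) * ‖(x 0).1‖) :
    IsExpStablePeriodicOrbit F (X ×ˢ Z) (iotaZero '' OZ) := by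
  have hD : IsOpen (X ×ˢ Z) := hX.prod hZ
  have hPS : ProperSpace (E × G) := FiniteDimensional.proper ℝ _
  obtain ⟨hper, r₀, N, γ, hr₀, hN, hγ, hst⟩ := hOZ
  have hne := hper.nonempty
  have hsub : (iotaZero '' OZ : Set (E × G)) ⊆ X ×ˢ Z := by
    rintro _ ⟨z, hz, rfl⟩
    exact ⟨hX0, hper.subset hz⟩
  have hfst : ∀ z ∈ Z, infDist z OZ < r → (F (0, z)).1 = 0 := fun z hz hzr =>
    fst_eq_zero_of_transverse_decay hD hF hdecay ⟨hX0, hz⟩ (by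
      rw [← infDist_iotaZero (E := E)] at hzr; exact hzr)
  refine ⟨?_, ?_⟩
  · obtain ⟨x, T, hT, hx, hxT, ⟨t, ht⟩, rfl⟩ := hper
    refine ⟨fun t => iotaZero (x t), T, hT, hx.iotaZero hX0 fun t _ => ?_, hxT.comp _, ⟨t, ?_⟩, ?_⟩
    · refine hfst _ (hx t (mem_univ t)).1 ?_
      rwa [infDist_zero_of_mem (mem_range_self t)]
    · exact fun h => ht (congrArg Prod.snd h)
    · rw [← range_comp]; rfl
  -- a compact tube around the lifted orbit, on which `F` is made globally Lipschitz
  have hOc : IsCompact (iotaZero '' OZ : Set (E × G)) :=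
    hper.isCompact.image isometry_iotaZero.continuous
  obtain ⟨ρ₀, hρ₀, hρD⟩ := hOc.exists_cthickening_subset_open hD hsub
  obtain ⟨C₀, hC₀⟩ := hF _ hρD hOc.cthickening
  obtain ⟨L, M₀, H, hH, hHM, hFH⟩ := exists_lipschitzWith_bounded_eqOn hOc.cthickening hC₀
  set O : Set (E × G) := iotaZero '' OZ with hO
  set ρ := min ρ₀ (r / 2)
  have hρ : 0 < ρ := lt_min hρ₀ (half_pos hr)
  have hρr : ρ < r := (min_le_right _ _).trans_lt (half_lt_self hr)
  have htube : ∀ q : E × G, infDist q O ≤ ρ → q ∈ cthickening ρ₀ O := fun q hq => by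
    rw [hOc.cthickening_eq_biUnion_closedBall hρ₀.le]
    obtain ⟨q', hq', hd⟩ := hOc.exists_infDist_eq_dist (hne.image _) q
    exact mem_biUnion hq' (mem_closedBall.2 (hd ▸ hq.trans (min_le_left _ _)))
  have hlift : ∀ z : ℝ → G, IsSolutionOn (fun z => (F (0, z)).2) Z z (Ici 0) →
      (∀ t, 0 ≤ t → infDist (z t) OZ ≤ ρ) →
      IsSolutionOn H univ (fun t => (iotaZero (z t) : E × G)) (Ici 0) := fun z hz hzρ =>
    (hz.iotaZero hX0 fun t ht => hfst _ (hz t ht).1 ((hzρ t ht).trans_lt hρr)).congr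
      (fun _ _ => mem_univ _) fun t ht => hFH (htube _ ((infDist_iotaZero _ _).trans_le (hzρ t ht)))
  -- rates: over the period `τ` half of the contraction of the zero dynamics beats the constant `N`
  set κ := min lam (γ / 2)
  have hκ : 0 < κ := lt_min hlam (half_pos hγ)
  obtain ⟨τ, hτ, hNτ⟩ : ∃ τ : ℝ, 0 < τ ∧ 2 * N ≤ Real.exp (γ / 2 * τ) := by
    refine ⟨2 * N * (2 / γ), by positivity, ?_⟩
    have : γ / 2 * (2 * N * (2 / γ)) = 2 * N := by field_simp
    rw [this]
    linarith [Real.add_one_le_exp (2 * N)]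
  have hq : N * Real.exp (-γ * τ) ≤ Real.exp (-κ * τ) / 2 := by
    have h1 : Real.exp (-γ * τ) * Real.exp (γ / 2 * τ) = Real.exp (-(γ / 2) * τ) := by
      rw [← Real.exp_add]; ring_nf
    have h2 : Real.exp (-(γ / 2) * τ) ≤ Real.exp (-κ * τ) := by
      have : κ ≤ γ / 2 := min_le_right _ _
      gcongr
    nlinarith [Real.exp_pos (-γ * τ)]
  set M' := max M 1
  set C := Real.exp (L * τ) * M' with hC
  have hM' : 1 ≤ M' := le_max_right _ _
  have hCpos : 0 < C := by positivity
  set B := max 1 (2 * C / Real.exp (-κ * τ))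
  have hB1 : 1 ≤ B := le_max_left _ _
  have hBC : 2 * C ≤ B * Real.exp (-κ * τ) :=
    (div_le_iff₀ (Real.exp_pos _)).1 (le_max_right _ _)
  have hBpos : 0 < B := one_pos.trans_le hB1
  have hA : 0 < N * B + C := by positivity
  refine ⟨min ρ (min (ρ / (N * B + C)) (r₀ / B)), (N * B + C) * Real.exp (κ * τ), κ,
    by positivity, by positivity, hκ, fun x₀ hx₀ hx₀r => ?_⟩
  obtain ⟨hδρ, hδA, hδB⟩ : infDist x₀ O < ρ ∧ infDist x₀ O < ρ / (N * B + C) ∧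
      infDist x₀ O < r₀ / B := by simpa using hx₀r
  rw [lt_div_iff₀ hA] at hδA
  rw [lt_div_iff₀ hBpos] at hδB
  obtain ⟨y, hy0, hy⟩ := exists_isSolutionOn_Ici hH hHM x₀
  have hyF : ∀ I ⊆ Ici (0 : ℝ), (∀ t ∈ I, infDist (y t) O ≤ ρ) → IsSolutionOn F (X ×ˢ Z) y I :=
    fun I hI hle => (hy.mono hI).congr (fun t ht => hρD (htube _ (hle t ht)))
      fun t ht => (hFH (htube _ (hle t ht))).symm
  have hydecay := exp_decay_of_periodic_contraction (Δ := fun t => infDist (y t) O) hτ hN hγ hκ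
    hCpos.le infDist_nonneg (fun t => infDist_nonneg) hq hB1 hBC
    ((mul_comm _ _).trans_le hδA.le) hδρ.le (by simp [hy0]) (by
      intro j hj hjB t ht
      have hjτ : (0 : ℝ) ≤ j * τ := by positivity
      have hyj : IsSolutionOn F (X ×ˢ Z) y (Icc 0 (j * τ)) := hyF _ Icc_subset_Ici_self hj
      have hη : ‖(y (j * τ)).1‖ ≤ M' * (Real.exp (-κ * τ) ^ j * infDist x₀ O) := by
        have hδ := norm_fst_le_infDist hne x₀
        rcases hjτ.eq_or_lt with h | h
        · have hj0 : j = 0 := by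
            simpa [hτ.ne'] using h.symm
          subst hj0
          simpa [hy0] using hδ.trans (le_mul_of_one_le_left infDist_nonneg hM')
        · have := hdecay y (j * τ) ⟨h, hyj, by rw [hy0]; exact hδρ.trans hρr⟩ _ ⟨hjτ, le_rfl⟩
          refine this.trans ?_
          rw [hy0, ← Real.exp_nat_mul, mul_assoc]
          have hkl : κ ≤ lam := min_le_left _ _
          have : Real.exp (-lam * (j * τ)) ≤ Real.exp (j * (-κ * τ)) := by
            rw [Real.exp_le_exp]; nlinarith
          gcongr
          exact le_max_left _ _
      refine (infDist_le_of_zeroDynamics hH hne hN hγ (fun z₀ h₁ h₂ => (hst z₀ h₁ h₂).1)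
        (fun z₀ h₁ h₂ => (hst z₀ h₁ h₂).2) hlift hy hjτ (hyj _ ⟨hjτ, le_rfl⟩).1.2
        (hjB.trans_lt ((mul_comm _ _).trans_lt hδB)) ?_ ht.1).trans ?_
      · have h1 := mul_le_mul_of_nonneg_left hjB hN.le
        have h2 : 0 ≤ C * infDist x₀ O := mul_nonneg hCpos.le infDist_nonneg
        exact h1.trans (by linarith)
      · rw [hC, mul_assoc (Real.exp (L * τ))]
        have hLt : (L : ℝ) * t ≤ L * τ := mul_le_mul_of_nonneg_left ht.2 L.2
        gcongr)
  have hyI := hyF _ subset_rfl fun t ht => (hydecay t ht).1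
  refine ⟨⟨y, hy0, hyI⟩, fun x hx0 hx t ht => ?_⟩
  have hxy := (hx.mono Icc_subset_Ici_self).eqOn hF (hyI.mono Icc_subset_Ici_self)
    (hx0.trans hy0.symm) (right_mem_Icc.2 ht)
  rw [hxy]
  exact (hydecay t ht).2

end Stability

/-! ### Transverse decay for the closed loop -/

section ClosedLoop

variable {E U G : Type*} [NormedAddCommGroup E] [NormedSpace ℝ E]
  [NormedAddCommGroup U] [NormedSpace ℝ U] [NormedAddCommGroup G]

lemma exists_lipschitzOnWith_closedLoop {X : Set E} {Z : Set G} {f : E → E}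
    {g : E → (U →L[ℝ] E)} {p : E → G → G} {μ : E → G → U}
    (hf : LocallyLipschitzOn X f) (hg : LocallyLipschitzOn X g)
    (hp : LocallyLipschitzOn (X ×ˢ Z) (fun q => p q.1 q.2))
    (hμ : LocallyLipschitzOn (X ×ˢ Z) (fun q => μ q.1 q.2))
    {K : Set (E × G)} (hKD : K ⊆ X ×ˢ Z) (hK : IsCompact K) :
    ∃ C, LipschitzOnWith C (closedLoop f g p μ) K := by
  have hK1 : IsCompact (Prod.fst '' K) := hK.image continuous_fst
  have hKX : Prod.fst '' K ⊆ X := image_subset_iff.2 fun q hq => (hKD hq).1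
  obtain ⟨Cf, hCf⟩ := (hf.mono hKX).exists_lipschitzOnWith_of_compact hK1
  obtain ⟨Cg, hCg⟩ := (hg.mono hKX).exists_lipschitzOnWith_of_compact hK1
  obtain ⟨Cp, hCp⟩ := (hp.mono hKD).exists_lipschitzOnWith_of_compact hK
  obtain ⟨Cm, hCm⟩ := (hμ.mono hKD).exists_lipschitzOnWith_of_compact hK
  obtain ⟨Bg, hBg⟩ := hK1.exists_bound_of_continuousOn hCg.continuousOn
  obtain ⟨Bm, hBm⟩ := hK.exists_bound_of_continuousOn hCm.continuousOn
  have hfst : LipschitzOnWith 1 (Prod.fst : E × G → E) K := LipschitzWith.prod_fst.lipschitzOnWith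
  have hprod : LipschitzOnWith (Real.toNNReal (Bg * Cm + Cg * Bm))
      (fun q : E × G => g q.1 (μ q.1 q.2)) K := by
    refine LipschitzOnWith.of_dist_le_mul fun a ha b hb => ?_
    have hg1 := hBg _ (mem_image_of_mem Prod.fst ha)
    have hm1 := hCm.dist_le_mul a ha b hb
    have hg2 := hCg.dist_le_mul _ (mem_image_of_mem Prod.fst ha) _ (mem_image_of_mem Prod.fst hb)
    have hd : dist a.1 b.1 ≤ dist a b := le_max_left _ _
    have hBm0 : 0 ≤ Bm := (norm_nonneg _).trans (hBm b hb)
    have e : g a.1 (μ a.1 a.2) - g b.1 (μ b.1 b.2) =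
        g a.1 (μ a.1 a.2 - μ b.1 b.2) + (g a.1 - g b.1) (μ b.1 b.2) := by
      rw [map_sub, sub_apply]; abel
    rw [dist_eq_norm] at hm1 hg2
    rw [dist_eq_norm, e]
    calc ‖g a.1 (μ a.1 a.2 - μ b.1 b.2) + (g a.1 - g b.1) (μ b.1 b.2)‖
        ≤ ‖g a.1‖ * ‖μ a.1 a.2 - μ b.1 b.2‖ + ‖g a.1 - g b.1‖ * ‖μ b.1 b.2‖ :=
          (norm_add_le _ _).trans
            (add_le_add (ContinuousLinearMap.le_opNorm _ _) (ContinuousLinearMap.le_opNorm _ _))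
      _ ≤ Bg * (Cm * dist a b) + (Cg * dist a b) * Bm := by
          gcongr
          · exact (norm_nonneg _).trans hg1
          · exact hg2.trans (by gcongr)
          · exact hBm b hb
      _ = (Bg * Cm + Cg * Bm) * dist a b := by ring
      _ ≤ _ := by
          gcongr
          exact Real.le_coe_toNNReal _
  exact ⟨_, ((hCf.comp hfst (mapsTo_image _ _)).add hprod).prodMk hCp⟩

variable [NormedSpace ℝ G]

/-- `VDot` is the derivative of `V` along closed-loop trajectories. -/
lemma IsSolutionOn.hasDerivWithinAt_lyapunov {X : Set E} {Z : Set G} {f : E → E}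
    {g : E → (U →L[ℝ] E)} {p : E → G → G} {μ : E → G → U} {V : E → ℝ}
    (hV : ∀ η ∈ X, DifferentiableAt ℝ V η) {x : ℝ → E × G} {I : Set ℝ}
    (hx : IsSolutionOn (closedLoop f g p μ) (X ×ˢ Z) x I) {t : ℝ} (ht : t ∈ I) :
    HasDerivWithinAt (fun s => V (x s).1) (VDot f g V (x t).1 (μ (x t).1 (x t).2)) I t := by
  have h := (hV _ (hx t ht).1.1).hasFDerivAt.comp_hasDerivWithinAt t (hx t ht).2.fst
  rw [closedLoop, map_add] at h
  exact h

/-- The decay estimate off `η = 0`, where the relaxed inequality is available. -/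
lemma norm_fst_le_of_relaxed {F : E × G → E × G} {f : E → E} {g : E → (U →L[ℝ] E)}
    {p : E → G → G} {μ : E → G → U} (hF : F = closedLoop f g p μ) {X : Set E} {Z : Set G}
    {O : Set (E × G)} {ε c₁ c₂ c₃ : ℝ} (hε : 0 < ε) (hc₁ : 0 < c₁) (hc₂ : 0 < c₂)
    {V : E → ℝ} (hVd : ∀ η ∈ X, DifferentiableAt ℝ V η)
    (hV : ∀ η ∈ X, c₁ * ‖η‖ ^ 2 ≤ V η ∧ V η ≤ c₂ / ε ^ 2 * ‖η‖ ^ 2)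
    {d : E × G → ℝ → ℝ} (hdm : ∀ x₀, Measurable (d x₀)) (hd : ∀ x₀ t, 0 ≤ t → 0 ≤ d x₀ t) {r : ℝ}
    (hrelax : ∀ x T, IsTrajectoryNear F (X ×ˢ Z) O r x T → (x 0).1 ≠ 0 → ∀ t ∈ Icc 0 T,
        VDot f g V (x t).1 (μ (x t).1 (x t).2) + c₃ / ε * V (x t).1 ≤ d (x 0) t)
    (hW : supRelaxation F (X ×ˢ Z) O r V d ≠ ⊤) {x : ℝ → E × G} {T : ℝ}
    (hx : IsTrajectoryNear F (X ×ˢ Z) O r x T) (hx0 : (x 0).1 ≠ 0) {t : ℝ} (ht : t ∈ Icc 0 T) :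
    ‖(x t).1‖ ≤ Real.sqrt (c₂ / c₁) * (1 / ε) *
      Real.exp ((supRelaxation F (X ×ˢ Z) O r V d).toReal / 2) *
        Real.exp (-(c₃ / (2 * ε)) * t) * ‖(x 0).1‖ := by
  set W := supRelaxation F (X ×ˢ Z) O r V d with hWdef
  have hsol := hx.2.1
  have h0 : (0 : ℝ) ∈ Icc 0 T := ⟨le_rfl, hx.1.le⟩
  have hXt : ∀ s ∈ Icc 0 T, (x s).1 ∈ X := fun s hs => (hsol s hs).1.1
  have hcum : cumulativeRelaxation V (d (x 0)) (fun τ => (x τ).1) T ≤ W :=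
    le_iSup_of_le x (le_iSup_of_le T (le_iSup_of_le hx (le_iSup_of_le hx0 le_rfl)))
  have hVt := le_mul_exp_of_relaxed_deriv_le (v := fun s => V (x s).1) (κ := c₃ / ε)
    (fun s hs => (by positivity : (0 : ℝ) ≤ c₁ * ‖(x s).1‖ ^ 2).trans (hV _ (hXt s hs)).1)
    (fun s hs => (hF ▸ hsol).hasDerivWithinAt_lyapunov hVd hs) (hdm (x 0))
    (fun s hs => hd _ s hs.1) (hrelax x T hx hx0) hW hcum ht
  set e := Real.exp (W.toReal / 2) * Real.exp (-(c₃ / (2 * ε)) * t) with he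
  have hee : Real.exp (W.toReal - c₃ / ε * t) = e ^ 2 := by
    rw [he, ← Real.exp_add, ← Real.exp_nat_mul]
    congr 1
    push_cast
    field_simp
    ring
  have hsq : (Real.sqrt (c₂ / c₁) * (1 / ε) * e * ‖(x 0).1‖) ^ 2 =
      (c₂ / ε ^ 2 * ‖(x 0).1‖ ^ 2 * e ^ 2) / c₁ := by
    rw [mul_pow, mul_pow, mul_pow, Real.sq_sqrt (by positivity)]
    field_simp
  rw [mul_assoc _ (Real.exp _) (Real.exp _), ← he]
  refine le_of_sq_le_sq ?_ (by positivity)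
  rw [hsq, le_div_iff₀ hc₁, mul_comm _ c₁]
  calc c₁ * ‖(x t).1‖ ^ 2 ≤ V (x t).1 := (hV _ (hXt t ht)).1
    _ ≤ V (x 0).1 * e ^ 2 := hee ▸ hVt
    _ ≤ c₂ / ε ^ 2 * ‖(x 0).1‖ ^ 2 * e ^ 2 := by
      gcongr
      exact (hV _ (hXt 0 h0)).2

/-- A linear bound on the transverse component extends, by continuous dependence on the initial
state, from the trajectories off `η = 0` to those that start on it. -/
lemma norm_fst_le_of_forall_ne_zero [FiniteDimensional ℝ E] [FiniteDimensional ℝ G]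
    {F : E × G → E × G} {D : Set (E × G)} (hD : IsOpen D)
    (hF : ∀ K ⊆ D, IsCompact K → ∃ C, LipschitzOnWith C F K) {O : Set (E × G)} {r : ℝ}
    {b : ℝ → ℝ} (hb : ∀ x T, IsTrajectoryNear F D O r x T → (x 0).1 ≠ 0 → ∀ t ∈ Icc 0 T,
      ‖(x t).1‖ ≤ b t * ‖(x 0).1‖) {x : ℝ → E × G} {T : ℝ} (hx : IsTrajectoryNear F D O r x T)
    {t : ℝ} (ht : t ∈ Icc 0 T) : ‖(x t).1‖ ≤ b t * ‖(x 0).1‖ := by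
  by_cases hx0 : (x 0).1 = 0
  swap
  · exact hb x T hx hx0 t ht
  rw [hx0, norm_zero, mul_zero]
  cases subsingleton_or_nontrivial E
  · simp [Subsingleton.elim (x t).1 0]
  obtain ⟨ρ, hρ, B, hnear⟩ := hx.2.1.exists_nearby hD hF
  obtain ⟨v, hv⟩ := exists_ne (0 : E)
  -- trajectories from the initial states displaced by `h • v`, as `h → 0`
  have hq : Continuous fun h : ℝ => x 0 + (h • v, (0 : G)) := by fun_prop
  have hev1 : ∀ᶠ h : ℝ in 𝓝 0, dist (x 0 + (h • v, (0 : G))) (x 0) < ρ :=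
    (hq.dist continuous_const).continuousAt.eventually_lt continuousAt_const (by simpa using hρ)
  have hev2 : ∀ᶠ h : ℝ in 𝓝 0, infDist (x 0 + (h • v, (0 : G))) O < r :=
    ((continuous_infDist_pt O).comp hq).continuousAt.eventually_lt continuousAt_const
      (by simpa only [Function.comp, zero_smul, Prod.mk_zero_zero, add_zero] using hx.2.2)
  have hbound : ∀ᶠ h : ℝ in 𝓝[>] 0, ‖(x t).1‖ ≤ (b t + B) * (h * ‖v‖) := by
    filter_upwards [nhdsWithin_le_nhds hev1, nhdsWithin_le_nhds hev2, self_mem_nhdsWithin]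
      with h h1 h2 (hpos : 0 < h)
    obtain ⟨y, hy0, hy, hyx⟩ := hnear _ h1
    have hfst : (y 0).1 = h • v := by simp [hy0, hx0]
    have hnorm : ‖(y 0).1‖ = h * ‖v‖ := by rw [hfst, norm_smul, Real.norm_of_nonneg hpos.le]
    have hdist : dist (x 0 + (h • v, (0 : G))) (x 0) = h * ‖v‖ := by
      rw [dist_eq_norm, add_sub_cancel_left, ← hnorm, hfst]
      simp [Prod.norm_def]
    have h3 := hb y T ⟨hx.1, hy, by rwa [hy0]⟩ (by rw [hfst]; exact smul_ne_zero hpos.ne' hv) t ht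
    have h4 := hyx t ht
    rw [hdist] at h4
    have h5 : ‖(x t).1‖ ≤ ‖(y t).1‖ + dist (y t) (x t) := by
      have : dist (y t).1 (x t).1 ≤ dist (y t) (x t) := le_max_left _ _
      rw [dist_comm, dist_eq_norm] at this
      linarith [norm_le_norm_add_norm_sub' (x t).1 (y t).1]
    rw [hnorm] at h3
    linarith
  have hlim : Filter.Tendsto (fun h : ℝ => (b t + B) * (h * ‖v‖)) (𝓝[>] 0) (𝓝 0) := by
    have : Continuous fun h : ℝ => (b t + B) * (h * ‖v‖) := by fun_prop
    simpa using (this.tendsto 0).mono_left nhdsWithin_le_nhds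
  exact ge_of_tendsto hlim hbound

end ClosedLoop

end RelaxedCLF

theorem theorem1 {n m k : ℕ}
    -- the domains of the output state `η` and of the uncontrolled state `z`
    (X : Set (EuclideanSpace ℝ (Fin n))) (Z : Set (EuclideanSpace ℝ (Fin k)))
    (hX : IsOpen X) (h0 : (0 : EuclideanSpace ℝ (Fin n)) ∈ X) (hZ : IsOpen Z)
    -- the control system and the feedback
    (f : EuclideanSpace ℝ (Fin n) → EuclideanSpace ℝ (Fin n))
    (g : EuclideanSpace ℝ (Fin n) → (EuclideanSpace ℝ (Fin m) →L[ℝ] EuclideanSpace ℝ (Fin n)))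
    (p : EuclideanSpace ℝ (Fin n) → EuclideanSpace ℝ (Fin k) → EuclideanSpace ℝ (Fin k))
    (μ : EuclideanSpace ℝ (Fin n) → EuclideanSpace ℝ (Fin k) → EuclideanSpace ℝ (Fin m))
    (hf : LocallyLipschitzOn X f) (hg : LocallyLipschitzOn X g)
    (hp : LocallyLipschitzOn (X ×ˢ Z) (fun q => p q.1 q.2))
    (hμ : LocallyLipschitzOn (X ×ˢ Z) (fun q => μ q.1 q.2))
    -- the exponentially stable periodic orbit of the zero dynamics
    (OZ : Set (EuclideanSpace ℝ (Fin k)))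
    (hOZ : RelaxedCLF.IsExpStablePeriodicOrbit (fun z => p 0 z) Z OZ)
    -- the Lyapunov function
    (ε c₁ c₂ c₃ : ℝ) (hε : 0 < ε) (hc₁ : 0 < c₁) (hc₂ : 0 < c₂) (hc₃ : 0 < c₃)
    (V : EuclideanSpace ℝ (Fin n) → ℝ) (hVd : ∀ η ∈ X, DifferentiableAt ℝ V η)
    (hV : ∀ η ∈ X, c₁ * ‖η‖ ^ 2 ≤ V η ∧ V η ≤ c₂ / ε ^ 2 * ‖η‖ ^ 2)
    -- the relaxation along the trajectory with a given initial state
    (d : EuclideanSpace ℝ (Fin n) × EuclideanSpace ℝ (Fin k) → ℝ → ℝ)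
    (hdm : ∀ x₀, Measurable (d x₀)) (hd : ∀ x₀ t, 0 ≤ t → 0 ≤ d x₀ t)
    -- the relaxed inequality, on all trajectories off `η = 0` that start near the lifted orbit
    (r : ℝ) (hr : 0 < r)
    (hrelax : ∀ x T, RelaxedCLF.IsTrajectoryNear (RelaxedCLF.closedLoop f g p μ) (X ×ˢ Z)
        (RelaxedCLF.iotaZero '' OZ) r x T → (x 0).1 ≠ 0 →
      ∀ t ∈ Set.Icc 0 T,
        RelaxedCLF.VDot f g V (x t).1 (μ (x t).1 (x t).2) + c₃ / ε * V (x t).1 ≤ d (x 0) t)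
    -- the total scaled relaxation is finite
    (hwbar : RelaxedCLF.supRelaxation (RelaxedCLF.closedLoop f g p μ) (X ×ˢ Z)
        (RelaxedCLF.iotaZero '' OZ) r V d ≠ ⊤) :
    (∀ x T, RelaxedCLF.IsTrajectoryNear (RelaxedCLF.closedLoop f g p μ) (X ×ˢ Z)
        (RelaxedCLF.iotaZero '' OZ) r x T →
      ∀ t ∈ Set.Icc 0 T,
        ‖(x t).1‖ ≤ Real.sqrt (c₂ / c₁) * (1 / ε) * Real.exp ((RelaxedCLF.supRelaxation
          (RelaxedCLF.closedLoop f g p μ) (X ×ˢ Z) (RelaxedCLF.iotaZero '' OZ) r V d).toReal / 2) *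
          Real.exp (-(c₃ / (2 * ε)) * t) * ‖(x 0).1‖) ∧
    RelaxedCLF.IsExpStablePeriodicOrbit (RelaxedCLF.closedLoop f g p μ) (X ×ˢ Z)
      (RelaxedCLF.iotaZero '' OZ) := by

  have hF : ∀ K ⊆ X ×ˢ Z, IsCompact K →
      ∃ C, LipschitzOnWith C (RelaxedCLF.closedLoop f g p μ) K :=
    fun _ hKD hK => RelaxedCLF.exists_lipschitzOnWith_closedLoop hf hg hp hμ hKD hK
  have hdecay := fun x T hx t ht => RelaxedCLF.norm_fst_le_of_forall_ne_zero (hX.prod hZ) hF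
    (fun x T hx hx0 t ht => RelaxedCLF.norm_fst_le_of_relaxed rfl hε hc₁ hc₂ hVd hV hdm hd hrelax
      hwbar hx hx0 ht) (x := x) (T := T) hx (t := t) ht
  exact ⟨hdecay, RelaxedCLF.isExpStablePeriodicOrbit_of_transverse_decay hX hZ h0 hF hOZ hr
    (by positivity) hdecay⟩
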